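/- Let $\Delta\ge 1$ be an integer, let $\rho_G\ge 1$ and $\epsilon\in(0,1)$, and let $\beta,\gamma,\lambda\in\mathbb R$ satisfy $0\le\beta\le\gamma$, $\gamma>0$ and $\lambda>0$. Let $G=(V,E)$ be a finite simple undirected graph of maximum degree $\Delta$ whose adjacency matrix ${\bf A}_G$ has spectral radius $\rho_G$ (the spectral radius $\rho(M)$ of a square matrix $M$ is the largest absolute value of its complex eigenvalues, and $0$ for the empty matrix). Let $\mu_G$ be the Gibbs distribution on $\{\pm1\}^V$ with parameters $(\beta,\gamma,\lambda)$, i.e. $$\mu_G(\sigma)\propto\lambda^{\#\{v\in V:\,\sigma(v)=1\}}\;\beta^{\#\{\{u,v\}\in E:\,\sigma(u)=\sigma(v)=1\}}\;\gamma^{\#\{\{u,v\}\in E:\,\sigma(u)=\sigma(v)=-1\}} .$$ For an integer $d\ge1$ let $$H_d(x_1,\dots,x_d)=\log\lambda+\sum_{i=1}^d\log\left(\frac{\beta e^{x_i}+1}{e^{x_i}+\gamma}\right),$$ with gradient $\nabla H_d$ on $\mathbb R^d$, extended by continuity to $[-\infty,+\infty]^d$. Put $\delta=\frac{1-\epsilon}{\rho_G}$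 and suppose that the functions $H_1,\dots,H_\Delta$ exhibit $\delta$-contraction, i.e. $$\|\nabla H_d(y)\|_\infty\le\delta\qquad\text{for all } d\in\{1,\dots,\Delta\}\text{ and all } y\in[-\infty,+\infty]^d .$$ Then for every $\Lambda\subseteq V$ and every $\tau\in\{\pm1\}^\Lambda$, the pairwise influence matrix $\mathcal I^{\Lambda,\tau}_G$, which is indexed by $V\setminus\Lambda$ and has the entries $$\mathcal I^{\Lambda,\tau}_G(w,u)=\mu_G\big(\sigma(u)=1\mid\sigma|_\Lambda=\tau,\ \sigma(w)=1\big)-\mu_G\big(\sigma(u)=1\mid\sigma|_\Lambda=\tau,\ \sigma(w)=-1\big),$$ satisfies $$\rho\big(\mathcal I^{\Lambda,\tau}_G\big)\le\frac1\epsilon .$$ -/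

import Mathlib

open scoped ENNReal

noncomputable section

namespace TwoSpin

/-! Spins are the units of the integers, so that the two spins are `1` and `-1`, and a
configuration on `V` is a function `V → ℤˣ`. -/

section Gibbs

variable {V : Type*} [Fintype V] [DecidableEq V]

/-- The unnormalised weight of a configuration:
`lam ^ (number of vertices with spin 1) * β ^ (number of edges with both ends 1)
  * γ ^ (number of edges with both ends -1)`. -/
def weight (G : SimpleGraph V) [DecidableRel G.Adj] (β γ lam : ℝ) (σ : V → ℤˣ) : ℝ :=
  lam ^ (Finset.univ.filter fun v => σ v = 1).card
    * β ^ (G.edgeFinset.filter fun e => ∀ v ∈ e, σ v = 1).card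
    * γ ^ (G.edgeFinset.filter fun e => ∀ v ∈ e, σ v = -1).card

/-- The Gibbs distribution: the probability of a configuration. -/
def gibbs (G : SimpleGraph V) [DecidableRel G.Adj] (β γ lam : ℝ) (σ : V → ℤˣ) : ℝ :=
  weight G β γ lam σ / ∑ σ' : V → ℤˣ, weight G β γ lam σ'

open Classical in
/-- The probability of a set of configurations under the Gibbs distribution. -/
def gibbsProb (G : SimpleGraph V) [DecidableRel G.Adj] (β γ lam : ℝ)
    (S : Set (V → ℤˣ)) : ℝ :=
  ∑ σ : V → ℤˣ, if σ ∈ S then gibbs G β γ lam σ else 0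

/-- The conditional Gibbs marginal: the probability that `u` has spin `s` given `S`
(for `0 < β`, `0 < γ`, `0 < lam` every nonempty `S` has positive probability). -/
def condMarginal (G : SimpleGraph V) [DecidableRel G.Adj] (β γ lam : ℝ)
    (u : V) (s : ℤˣ) (S : Set (V → ℤˣ)) : ℝ :=
  gibbsProb G β γ lam ({σ | σ u = s} ∩ S) / gibbsProb G β γ lam S

/-- The event that the configuration at `Λ` is `τ`. -/
def pinned (Λ : Finset V) (τ : Λ → ℤˣ) : Set (V → ℤˣ) :=
  {σ | ∀ v : Λ, σ v = τ v}

/-- The pairwise influence matrix, indexed by the vertices outside `Λ`. -/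
def influence (G : SimpleGraph V) [DecidableRel G.Adj] (β γ lam : ℝ)
    (Λ : Finset V) (τ : Λ → ℤˣ) : Matrix {v : V // v ∉ Λ} {v : V // v ∉ Λ} ℝ :=
  Matrix.of fun w u =>
    condMarginal G β γ lam u 1 (pinned Λ τ ∩ {σ | σ w = 1})
      - condMarginal G β γ lam u 1 (pinned Λ τ ∩ {σ | σ w = -1})

end Gibbs

/-- The spectral radius of a real square matrix: the largest absolute value of its
complex eigenvalues. -/
def specRadius {n : Type*} [Fintype n] [DecidableEq n] (M : Matrix n n ℝ) : ℝ≥0∞ :=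
  spectralRadius ℂ (M.map (fun x : ℝ => (x : ℂ)))

/-- The tree recursion for log-ratios at a vertex with `d` children, at finite log-ratios. -/
def H (β γ lam : ℝ) (d : ℕ) (y : Fin d → ℝ) : ℝ :=
  Real.log lam + ∑ i, Real.log ((β * Real.exp (y i) + 1) / (Real.exp (y i) + γ))

/-- The vector of partial derivatives of `H` at a finite point. -/
def partials (β γ lam : ℝ) (d : ℕ) (y : Fin d → ℝ) : Fin d → ℝ :=
  fun i => deriv (fun t : ℝ => H β γ lam d (Function.update y i t)) (y i)

/-- The gradient of `H` on `[-∞, +∞]^d`: the continuous extension of the gradient at finite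
points. -/
def gradH (β γ lam : ℝ) (d : ℕ) (y : Fin d → EReal) : Fin d → ℝ :=
  Filter.limUnder (Filter.comap (fun (x : Fin d → ℝ) (i : Fin d) => (x i : EReal)) (nhds y))
    (partials β γ lam d)

/-- `δ`-contraction of `H_1, …, H_Δ`: the sup norm of the gradient is at most `δ` everywhere on
`[-∞, +∞]^d`. (The norm of `Fin d → ℝ` is the sup norm.) -/
def DeltaContraction (Δ : ℕ) (β γ lam δ : ℝ) : Prop :=
  ∀ d : ℕ, 1 ≤ d → d ≤ Δ → ∀ y : Fin d → EReal, ‖gradH β γ lam d y‖ ≤ δ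

end TwoSpin

end

/-! The proof is Dobrushin's comparison method. For a measure with positive density, flipping the
spin at `j` changes the conditional probability of spin 1 at `u` by at most some `K u j`. Only
neighbours matter here. If `r` is the odds of spin 1 at `u` when the neighbour `j` has spin -1, the
odds are `β * γ * r` when `j` has spin 1. The resulting change of probability is a one-variable
derivative of the recursion, evaluated at `exp y = γ * r`, so contraction for `d = 1` already gives
`K = δ A` (`DeltaContraction.abs_ratio_le`, `abs_siteProb_weight_sub_le`).

Heat-bath updates at free sites preserve both conditioned measures. Applying them repeatedly to an
observable improves any bound on the difference of its expectations, until that bound falls to any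
supersolution of the system defined by `K` (`dominatesDiff_of_supersolution`). Row `w` of `N = (1 -
K)⁻¹` is such a supersolution, whatever the pinning, so the influence of `w` on `u` is at most `N w
u` in absolute value (`abs_influence_le`).

Since `A` is symmetric, its ℓ² norm is at most its spectral radius `ρ`. Hence `‖K‖ ≤ 1 - ε`, and the
Neumann series gives `‖N‖ ≤ 1 / ε`. Entrywise domination carries this bound to the spectral radius
of the influence matrix (`specRadius_le_of_abs_le`). -/

namespace TwoSpin

/-! ### Dobrushin comparison for positive densities on spin configurations. -/

section Dobrushin

variable {V : Type*} [DecidableEq V]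

/-- The conditional probability of spin `1` at `u` given the spins of `σ` elsewhere, for the
measure with density `W`. -/
noncomputable def siteProb (W : (V → ℤˣ) → ℝ) (u : V) (σ : V → ℤˣ) : ℝ :=
  W (Function.update σ u 1) / (W (Function.update σ u 1) + W (Function.update σ u (-1)))

/-- The heat-bath update at `u`, acting on observables. -/
noncomputable def resample (W : (V → ℤˣ) → ℝ) (u : V) (f : (V → ℤˣ) → ℝ) (σ : V → ℤˣ) : ℝ :=
  siteProb W u σ * f (Function.update σ u 1)
    + (1 - siteProb W u σ) * f (Function.update σ u (-1))

/-- The expectation of `f` under the measure with density `W` conditioned on `S`. -/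
noncomputable def condExpect (W : (V → ℤˣ) → ℝ) (S : Finset (V → ℤˣ)) (f : (V → ℤˣ) → ℝ) : ℝ :=
  (∑ σ ∈ S, W σ * f σ) / ∑ σ ∈ S, W σ

/-- Flipping the spin at `j` changes `f` by at most `L j`. -/
def OscLE (f : (V → ℤˣ) → ℝ) (L : V → ℝ) : Prop :=
  ∀ σ j, |f (Function.update σ j 1) - f (Function.update σ j (-1))| ≤ L j

lemma OscLE.nonneg {f : (V → ℤˣ) → ℝ} {L : V → ℝ} (h : OscLE f L) (j : V) : 0 ≤ L j :=
  (abs_nonneg _).trans (h 1 j)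

lemma OscLE.abs_sub_update_le {f : (V → ℤˣ) → ℝ} {L : V → ℝ} (h : OscLE f L)
    (σ : V → ℤˣ) (j : V) (s : ℤˣ) : |f σ - f (Function.update σ j s)| ≤ L j := by
  have h0 := h.nonneg j
  have h1 := h σ j
  have h2 : Function.update σ j (σ j) = σ := Function.update_eq_self j σ
  rcases Int.units_eq_one_or (σ j) with hj | hj <;> rw [hj] at h2 <;> rw [h2] at h1 <;>
    rcases Int.units_eq_one_or s with rfl | rfl
  · simpa [h2] using h0
  · exact h1
  · rwa [abs_sub_comm]
  · simpa [h2] using h0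

lemma OscLE.abs_sub_le_sum {f : (V → ℤˣ) → ℝ} {L : V → ℝ} (h : OscLE f L) (D : Finset V) :
    ∀ σ σ' : V → ℤˣ, (∀ j ∉ D, σ j = σ' j) → |f σ - f σ'| ≤ ∑ j ∈ D, L j := by
  induction D using Finset.induction_on with
  | empty =>
    intro σ σ' hσ
    have : σ = σ' := funext fun j => hσ j (by simp)
    simp [this]
  | insert u D hu ih =>
    intro σ σ' hσ
    rw [Finset.sum_insert hu]
    have h1 := h.abs_sub_update_le σ u (σ' u)
    have h2 := ih (Function.update σ u (σ' u)) σ' (by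
      intro j hj
      by_cases hju : j = u
      · subst hju; simp
      · rw [Function.update_of_ne hju]
        exact hσ j (by simp [hju, hj]))
    calc |f σ - f σ'| ≤ _ := abs_sub_le _ (f (Function.update σ u (σ' u))) _
      _ ≤ _ := add_le_add h1 h2

/-- Reversibility of the heat bath: the difference of the two sums cancels between each
configuration and its flip at `u`, which stays in `S`. -/
lemma condExpect_resample {W : (V → ℤˣ) → ℝ} (hW : ∀ σ, 0 < W σ) {S : Finset (V → ℤˣ)} {u : V}
    (hS : ∀ σ ∈ S, ∀ s, Function.update σ u s ∈ S) (f : (V → ℤˣ) → ℝ) :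
    condExpect W S (resample W u f) = condExpect W S f := by
  unfold condExpect
  congr 1
  rw [← sub_eq_zero, ← Finset.sum_sub_distrib]
  refine Finset.sum_involution (fun σ _ => Function.update σ u (-(σ u))) ?_ ?_
    (fun σ hσ => hS σ hσ _) (by simp)
  · intro σ _
    have h1 := hW (Function.update σ u 1)
    have h2 := hW (Function.update σ u (-1))
    have h3 := (add_pos h1 h2).ne'
    have h4 : Function.update σ u (σ u) = σ := Function.update_eq_self u σ
    simp only [resample, siteProb, Function.update_idem]
    rcases Int.units_eq_one_or (σ u) with hu | hu <;> rw [hu] at h4 <;>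
      simp only [hu, neg_neg, h4] at * <;> field_simp <;> ring
  · intro σ _ _ h
    have := congrFun h u
    simp only [Function.update_self] at this
    rcases Int.units_eq_one_or (σ u) with hu | hu <;> rw [hu] at this <;> revert this <;> decide

lemma siteProb_nonneg {W : (V → ℤˣ) → ℝ} (hW : ∀ σ, 0 < W σ) (u : V) (σ : V → ℤˣ) :
    0 ≤ siteProb W u σ :=
  div_nonneg (hW _).le (add_pos (hW _) (hW _)).le

lemma siteProb_le_one {W : (V → ℤˣ) → ℝ} (hW : ∀ σ, 0 < W σ) (u : V) (σ : V → ℤˣ) :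
    siteProb W u σ ≤ 1 :=
  div_le_one_of_le₀ (le_add_of_nonneg_right (hW _).le) (add_pos (hW _) (hW _)).le

lemma OscLE.resample {W : (V → ℤˣ) → ℝ} (hW : ∀ σ, 0 < W σ) {f : (V → ℤˣ) → ℝ} {L : V → ℝ}
    (hf : OscLE f L) {u : V} {R : V → ℝ}
    (hR : ∀ σ j, j ≠ u → |siteProb W u (Function.update σ j 1)
      - siteProb W u (Function.update σ j (-1))| ≤ R j) :
    OscLE (resample W u f) (fun j => if j = u then 0 else L j + R j * L u) := by
  intro σ j
  by_cases hj : j = u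
  · subst hj
    simp [TwoSpin.resample, siteProb]
  · simp only [hj, if_false]
    have e (s t : ℤˣ) : Function.update (Function.update σ j s) u t
        = Function.update (Function.update σ u t) j s := Function.update_comm hj _ _ _
    have h1 := hf (Function.update σ u 1) j
    have h2 := hf (Function.update σ u (-1)) j
    have h3 := hf (Function.update σ j (-1)) u
    have h4 := hR σ j hj
    have h5 := siteProb_nonneg hW u (Function.update σ j 1)
    have h6 := siteProb_le_one hW u (Function.update σ j 1)
    unfold TwoSpin.resample
    rw [← e, ← e] at h1 h2
    generalize siteProb W u (Function.update σ j 1) = p at *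
    generalize siteProb W u (Function.update σ j (-1)) = q at *
    generalize f (Function.update (Function.update σ j 1) u 1) = x₁ at *
    generalize f (Function.update (Function.update σ j 1) u (-1)) = x₂ at *
    generalize f (Function.update (Function.update σ j (-1)) u 1) = x₃ at *
    generalize f (Function.update (Function.update σ j (-1)) u (-1)) = x₄ at *
    -- Couple the two updates: either the new spin at `u` is common and only `j` differs, or the
    -- spins at `u` disagree, at a cost controlled by `p - q`.
    have e1 : p * x₁ + (1 - p) * x₂ - (q * x₃ + (1 - q) * x₄)
        = p * (x₁ - x₃) + (1 - p) * (x₂ - x₄) + (p - q) * (x₃ - x₄) := by ring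
    have g1 : |p * (x₁ - x₃)| ≤ p * L j := by
      rw [abs_mul, abs_of_nonneg h5]; exact mul_le_mul_of_nonneg_left h1 h5
    have g2 : |(1 - p) * (x₂ - x₄)| ≤ (1 - p) * L j := by
      rw [abs_mul, abs_of_nonneg (sub_nonneg.2 h6)]
      exact mul_le_mul_of_nonneg_left h2 (sub_nonneg.2 h6)
    have g3 : |(p - q) * (x₃ - x₄)| ≤ R j * L u := by
      rw [abs_mul]; exact mul_le_mul h4 h3 (abs_nonneg _) ((abs_nonneg _).trans h4)
    rw [e1]
    have := abs_add_three (p * (x₁ - x₃)) ((1 - p) * (x₂ - x₄)) ((p - q) * (x₃ - x₄))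
    linarith

variable [Fintype V]

/-- The vector `a` dominates the difference between conditioning on `S` and on `T`. -/
def DominatesDiff (W : (V → ℤˣ) → ℝ) (S T : Finset (V → ℤˣ)) (a : V → ℝ) : Prop :=
  ∀ f L, OscLE f L → |condExpect W S f - condExpect W T f| ≤ ∑ j, a j * L j

lemma DominatesDiff.mono {W : (V → ℤˣ) → ℝ} {S T : Finset (V → ℤˣ)} {a a' : V → ℝ}
    (h : DominatesDiff W S T a) (haa' : ∀ j, a j ≤ a' j) : DominatesDiff W S T a' :=
  fun f L hf => (h f L hf).trans
    (Finset.sum_le_sum fun j _ => mul_le_mul_of_nonneg_right (haa' j) (hf.nonneg j))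

/-- Apply the hypothesis to `resample W u f`, which has the same two expectations as `f`. Its
oscillation at `u` vanishes, and each `L j` gains `R j * L u`; collecting the coefficient of `L u`
gives the new entry. -/
lemma DominatesDiff.update {W : (V → ℤˣ) → ℝ} (hW : ∀ σ, 0 < W σ) {S T : Finset (V → ℤˣ)}
    {a : V → ℝ} (h : DominatesDiff W S T a) {u : V} {R : V → ℝ} (hRu : R u = 0)
    (hS : ∀ σ ∈ S, ∀ s, Function.update σ u s ∈ S)
    (hT : ∀ σ ∈ T, ∀ s, Function.update σ u s ∈ T)
    (hR : ∀ σ j, j ≠ u → |siteProb W u (Function.update σ j 1)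
      - siteProb W u (Function.update σ j (-1))| ≤ R j) :
    DominatesDiff W S T (Function.update a u (∑ j, R j * a j)) := by
  intro f L hf
  have h1 := h _ _ (hf.resample hW hR)
  rw [condExpect_resample hW hS, condExpect_resample hW hT] at h1
  refine h1.trans (le_of_eq ?_)
  rw [← Finset.add_sum_erase _ _ (Finset.mem_univ u),
    ← Finset.add_sum_erase (a := u) Finset.univ
      (fun j => Function.update a u (∑ j, R j * a j) j * L j) (Finset.mem_univ u),
    ← Finset.add_sum_erase _ (fun j => R j * a j) (Finset.mem_univ u)]
  simp only [if_true, mul_zero, zero_add, Function.update_self, hRu, zero_mul]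
  rw [Finset.sum_mul, ← Finset.sum_add_distrib]
  refine Finset.sum_congr rfl fun j hj => ?_
  have hju : j ≠ u := Finset.ne_of_mem_erase hj
  rw [Function.update_of_ne hju, if_neg hju]
  ring

/-- One round of updates at all the sites of `F`. -/
lemma DominatesDiff.sweep {W : (V → ℤˣ) → ℝ} (hW : ∀ σ, 0 < W σ) {S T : Finset (V → ℤˣ)}
    {K : Matrix V V ℝ} (hK : ∀ i j, 0 ≤ K i j) (hK0 : ∀ i, K i i = 0)
    (hKW : ∀ u σ j, j ≠ u → |siteProb W u (Function.update σ j 1)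
      - siteProb W u (Function.update σ j (-1))| ≤ K u j)
    {F : Finset V} (hS : ∀ u ∈ F, ∀ σ ∈ S, ∀ s, Function.update σ u s ∈ S)
    (hT : ∀ u ∈ F, ∀ σ ∈ T, ∀ s, Function.update σ u s ∈ T)
    {a a' : V → ℝ} (h : DominatesDiff W S T a) (haa' : ∀ j, a' j ≤ a j)
    (hoff : ∀ j ∉ F, a' j = a j) (hon : ∀ u ∈ F, ∑ j, K u j * a j ≤ a' u) :
    DominatesDiff W S T a' := by
  have key (s : Finset V) (hs : s ⊆ F) :
      DominatesDiff W S T (fun j => if j ∈ s then a' j else a j) := by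
    induction s using Finset.induction_on with
    | empty => simpa using h
    | insert u s _ ih =>
      have huF : u ∈ F := hs (Finset.mem_insert_self _ _)
      refine ((ih ((Finset.subset_insert _ _).trans hs)).update hW (hK0 u) (hS u huF) (hT u huF)
        (hKW u)).mono fun j => ?_
      by_cases hj : j = u
      · subst hj
        rw [Function.update_self, if_pos (Finset.mem_insert_self _ _)]
        -- Sites already updated carry the smaller value `a'`, so the bound computed from `a` still
        -- holds because `K` is nonnegative.
        refine le_trans (Finset.sum_le_sum fun i _ => mul_le_mul_of_nonneg_left ?_ (hK _ _))
          (hon j huF)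
        split_ifs
        exacts [haa' i, le_rfl]
      · rw [Function.update_of_ne hj]
        simp [hj]
  refine (key F subset_rfl).mono fun j => ?_
  split_ifs with hj
  exacts [le_rfl, (hoff j hj).ge]

lemma dominatesDiff_indicator {W : (V → ℤˣ) → ℝ} (hW : ∀ σ, 0 < W σ) {S T : Finset (V → ℤˣ)}
    (hS : S.Nonempty) (hT : T.Nonempty) {D : Finset V}
    (hD : ∀ σ ∈ S, ∀ σ' ∈ T, ∀ j ∉ D, σ j = σ' j) :
    DominatesDiff W S T (fun j => if j ∈ D then 1 else 0) := by
  intro f L hf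
  simp only [ite_mul, one_mul, zero_mul, Finset.sum_ite_mem, Finset.univ_inter]
  have hZS : 0 < ∑ σ ∈ S, W σ := Finset.sum_pos (fun σ _ => hW σ) hS
  have hZT : 0 < ∑ σ ∈ T, W σ := Finset.sum_pos (fun σ _ => hW σ) hT
  unfold condExpect
  rw [div_sub_div _ _ hZS.ne' hZT.ne', abs_div, abs_of_pos (mul_pos hZS hZT),
    div_le_iff₀ (mul_pos hZS hZT)]
  have e : (∑ σ ∈ S, W σ * f σ) * (∑ σ ∈ T, W σ) - (∑ σ ∈ S, W σ) * ∑ σ ∈ T, W σ * f σ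
      = ∑ σ ∈ S, ∑ σ' ∈ T, W σ * W σ' * (f σ - f σ') := by
    rw [Finset.sum_mul_sum, Finset.sum_mul_sum, ← Finset.sum_sub_distrib]
    refine Finset.sum_congr rfl fun σ _ => ?_
    rw [← Finset.sum_sub_distrib]
    exact Finset.sum_congr rfl fun σ' _ => by ring
  rw [e, Finset.sum_mul_sum, Finset.mul_sum]
  refine (Finset.abs_sum_le_sum_abs _ _).trans (Finset.sum_le_sum fun σ hσ => ?_)
  rw [Finset.mul_sum]
  refine (Finset.abs_sum_le_sum_abs _ _).trans (Finset.sum_le_sum fun σ' hσ' => ?_)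
  have hp := mul_pos (hW σ) (hW σ')
  rw [abs_mul, abs_of_pos hp, mul_comm]
  exact mul_le_mul_of_nonneg_right (hf.abs_sub_le_sum D σ σ' (hD σ hσ σ' hσ')) hp.le

/-- Dobrushin's comparison: any supersolution `b` of the one-site contraction system dominates
the difference between two conditionings that agree off `D` and leave the sites of `F` free. -/
theorem dominatesDiff_of_supersolution {W : (V → ℤˣ) → ℝ} (hW : ∀ σ, 0 < W σ)
    {S T : Finset (V → ℤˣ)} (hSne : S.Nonempty) (hTne : T.Nonempty)
    {K : Matrix V V ℝ} (hK : ∀ i j, 0 ≤ K i j) (hK0 : ∀ i, K i i = 0)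
    (hKW : ∀ u σ j, j ≠ u → |siteProb W u (Function.update σ j 1)
      - siteProb W u (Function.update σ j (-1))| ≤ K u j)
    {D F : Finset V} (hD : ∀ σ ∈ S, ∀ σ' ∈ T, ∀ j ∉ D, σ j = σ' j)
    (hS : ∀ u ∈ F, ∀ σ ∈ S, ∀ s, Function.update σ u s ∈ S)
    (hT : ∀ u ∈ F, ∀ σ ∈ T, ∀ s, Function.update σ u s ∈ T)
    {b c : V → ℝ} (hb : ∀ j, 0 ≤ b j) (hbD : ∀ j ∈ D, j ∉ F → 1 ≤ b j)
    (hKb : ∀ u ∈ F, ∑ j, K u j * b j ≤ b u)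
    {θ : ℝ} (hθ0 : 0 ≤ θ) (hθ1 : θ < 1) (hc : ∀ j, 1 ≤ c j)
    (hKc : ∀ u, ∑ j, K u j * c j ≤ θ * c u) :
    DominatesDiff W S T b := by
  have hc0 (j : V) : 0 ≤ c j := zero_le_one.trans (hc j)
  have hite (j : V) (h : j ∉ F) : (if j ∈ D then (1 : ℝ) else 0) ≤ b j := by
    split_ifs with hj
    exacts [hbD j hj h, hb j]
  -- The error over `b` at the free sites shrinks by `θ` in each sweep, measured against the weight
  -- `c`; the other sites keep their initial bound.
  have key (n : ℕ) : DominatesDiff W S T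
      (fun j => if j ∈ F then b j + θ ^ n * c j else if j ∈ D then 1 else 0) := by
    induction n with
    | zero =>
      refine (dominatesDiff_indicator hW hSne hTne hD).mono fun j => ?_
      by_cases hj : j ∈ F
      · have := hb j
        have := hc j
        simp only [hj, if_true, pow_zero, one_mul]
        split_ifs <;> linarith
      · simp only [hj, if_false, le_refl]
    | succ n ih =>
      have hθn : 0 ≤ θ ^ n := pow_nonneg hθ0 n
      refine ih.sweep hW hK hK0 hKW hS hT (fun j => ?_) (fun j hj => by simp only [hj, if_false])
        fun u hu => ?_
      · split_ifs
        · have : θ ^ (n + 1) ≤ θ ^ n := pow_le_pow_of_le_one hθ0 hθ1.le n.le_succ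
          linarith [mul_le_mul_of_nonneg_right this (hc0 j)]
        · exact le_rfl
        · exact le_rfl
      · simp only [hu, if_true]
        calc _ ≤ ∑ j, K u j * (b j + θ ^ n * c j) :=
              Finset.sum_le_sum fun j _ => mul_le_mul_of_nonneg_left (by
                have := mul_nonneg hθn (hc0 j)
                by_cases hj : j ∈ F
                · simp only [hj, if_true, le_refl]
                · simp only [hj, if_false]
                  linarith [hite j hj]) (hK u j)
          _ = ∑ j, K u j * b j + θ ^ n * ∑ j, K u j * c j := by
              rw [Finset.mul_sum, ← Finset.sum_add_distrib]
              exact Finset.sum_congr rfl fun j _ => by ring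
          _ ≤ b u + θ ^ n * (θ * c u) :=
              add_le_add (hKb u hu) (mul_le_mul_of_nonneg_left (hKc u) hθn)
          _ = _ := by ring
  intro f L hf
  have hlim : Filter.Tendsto (fun n : ℕ => ∑ j, (b j + θ ^ n * c j) * L j) Filter.atTop
      (nhds (∑ j, (b j + 0 * c j) * L j)) :=
    tendsto_finsetSum _ fun j _ => (((tendsto_pow_atTop_nhds_zero_of_lt_one hθ0 hθ1).mul_const
      (c j)).const_add (b j)).mul_const (L j)
  simp only [zero_mul, add_zero] at hlim
  refine ge_of_tendsto' hlim fun n => ((key n).mono fun j => ?_) f L hf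
  have := mul_nonneg (pow_nonneg hθ0 n) (hc0 j)
  by_cases hj : j ∈ F
  · simp only [hj, if_true, le_refl]
  · simp only [hj, if_false]
    linarith [hite j hj]

end Dobrushin

/-! ### One-site influences of the two-spin weight. -/

section WeightRatio

variable {V : Type*} [Fintype V] [DecidableEq V] (G : SimpleGraph V) [DecidableRel G.Adj]
  {β γ lam : ℝ}

lemma weight_pos (hβ : 0 < β) (hγ : 0 < γ) (hlam : 0 < lam) (σ : V → ℤˣ) :
    0 < weight G β γ lam σ := by
  unfold weight
  positivity

/-- The contribution of an edge to the weight. -/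
noncomputable def edgeFactor (β γ : ℝ) (σ : V → ℤˣ) (e : Sym2 V) : ℝ :=
  (if ∀ v ∈ e, σ v = 1 then β else 1) * (if ∀ v ∈ e, σ v = -1 then γ else 1)

lemma weight_eq_prod (σ : V → ℤˣ) :
    weight G β γ lam σ
      = (∏ v, if σ v = 1 then lam else 1) * ∏ e ∈ G.edgeFinset, edgeFactor β γ σ e := by
  simp only [weight, edgeFactor, Finset.prod_mul_distrib, Finset.prod_ite, Finset.prod_const,
    one_pow, mul_one, mul_assoc]

lemma edgeFactor_update {e : Sym2 V} {u : V} (hu : u ∉ e) (σ : V → ℤˣ) (s : ℤˣ) :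
    edgeFactor β γ (Function.update σ u s) e = edgeFactor β γ σ e := by
  have h (t : ℤˣ) : (∀ v ∈ e, Function.update σ u s v = t) ↔ ∀ v ∈ e, σ v = t :=
    forall₂_congr fun v hv => by
      rw [Function.update_of_ne (ne_of_mem_of_not_mem hv hu)]
  simp only [edgeFactor, h]

/-- Only the edge joining `u` and `j` sees both spins; for any other edge the two sides use the same
factors. -/
lemma edgeFactor_mul {u j : V} (huj : j ≠ u) (σ : V → ℤˣ) (e : Sym2 V) :
    edgeFactor β γ (Function.update (Function.update σ j 1) u 1) e
        * edgeFactor β γ (Function.update (Function.update σ j (-1)) u (-1)) e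
      = (if e = s(u, j) then β * γ else 1)
        * (edgeFactor β γ (Function.update (Function.update σ j (-1)) u 1) e
          * edgeFactor β γ (Function.update (Function.update σ j 1) u (-1)) e) := by
  by_cases he : e = s(u, j)
  · subst he
    have h1 : ¬ (1 : ℤˣ) = -1 := by decide
    have h2 : ¬ (-1 : ℤˣ) = 1 := by decide
    simp [edgeFactor, Function.update_of_ne huj, h1, h2]
  · rw [if_neg he, one_mul]
    by_cases hu : u ∈ e
    · have hj : j ∉ e := fun hj => he ((Sym2.mem_and_mem_iff huj.symm).1 ⟨hu, hj⟩)
      simp only [Function.update_comm huj, edgeFactor_update hj]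
    · simp only [edgeFactor_update hu, mul_comm]

/-- The ratio of weights at `u` changes by the factor `β * γ` when the spin of a neighbour is
flipped, and is insensitive to the other spins. -/
lemma weight_mul {u j : V} (huj : j ≠ u) (σ : V → ℤˣ) :
    weight G β γ lam (Function.update (Function.update σ j 1) u 1)
        * weight G β γ lam (Function.update (Function.update σ j (-1)) u (-1))
      = (if G.Adj u j then β * γ else 1)
        * (weight G β γ lam (Function.update (Function.update σ j (-1)) u 1)
          * weight G β γ lam (Function.update (Function.update σ j 1) u (-1))) := by
  have hE : (∏ e ∈ G.edgeFinset, if e = s(u, j) then β * γ else 1)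
      = if G.Adj u j then β * γ else 1 := by
    simp [Finset.prod_ite_eq']
  have hE' := Finset.prod_congr (rfl : G.edgeFinset = G.edgeFinset)
    fun e _ => edgeFactor_mul (β := β) (γ := γ) huj σ e
  simp only [Finset.prod_mul_distrib] at hE'
  rw [hE] at hE'
  have hV : (∏ v, if Function.update (Function.update σ j 1) u 1 v = 1 then lam else 1)
      * (∏ v, if Function.update (Function.update σ j (-1)) u (-1) v = 1 then lam else 1)
      = (∏ v, if Function.update (Function.update σ j (-1)) u 1 v = 1 then lam else 1)
      * ∏ v, if Function.update (Function.update σ j 1) u (-1) v = 1 then lam else 1 := by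
    rw [← Finset.prod_mul_distrib, ← Finset.prod_mul_distrib]
    refine Finset.prod_congr rfl fun v _ => ?_
    by_cases hv : v = u
    · subst hv; simp
    · simp only [Function.update_of_ne hv, mul_comm]
  simp only [weight_eq_prod]
  rw [mul_mul_mul_comm, hV, hE']
  ring

lemma abs_siteProb_weight_sub_le (hβ : 0 < β) (hγ : 0 < γ) (hlam : 0 < lam) {δ : ℝ}
    (hδ : ∀ r : ℝ, 0 < r → |(β * γ - 1) * r / ((1 + β * γ * r) * (1 + r))| ≤ δ)
    (u : V) (σ : V → ℤˣ) (j : V) (huj : j ≠ u) :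
    |siteProb (weight G β γ lam) u (Function.update σ j 1)
      - siteProb (weight G β γ lam) u (Function.update σ j (-1))|
      ≤ (δ • G.adjMatrix ℝ) u j := by
  have hW := weight_pos G hβ hγ hlam
  have h := weight_mul G (β := β) (γ := γ) (lam := lam) huj σ
  unfold siteProb
  have h1 := hW (Function.update (Function.update σ j 1) u 1)
  have h2 := hW (Function.update (Function.update σ j 1) u (-1))
  have h3 := hW (Function.update (Function.update σ j (-1)) u 1)
  have h4 := hW (Function.update (Function.update σ j (-1)) u (-1))
  generalize weight G β γ lam (Function.update (Function.update σ j 1) u 1) = a at *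
  generalize weight G β γ lam (Function.update (Function.update σ j 1) u (-1)) = b at *
  generalize weight G β γ lam (Function.update (Function.update σ j (-1)) u 1) = c at *
  generalize weight G β γ lam (Function.update (Function.update σ j (-1)) u (-1)) = d at *
  by_cases hadj : G.Adj u j
  · rw [if_pos hadj] at h
    have ha : a = β * γ * c * b / d := by
      rw [eq_div_iff h4.ne', h]; ring
    have hbg : 0 < β * γ := mul_pos hβ hγ
    -- Here `c / d` is the odds at `u` when `j` has spin -1.
    have key : a / (a + b) - c / (c + d)
        = (β * γ - 1) * (c / d) / ((1 + β * γ * (c / d)) * (1 + c / d)) := by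
      have : 0 < β * γ * c + d := by positivity
      have : 0 < d + β * γ * c := by positivity
      rw [ha]
      field_simp
      ring
    rw [key]
    simpa [SimpleGraph.adjMatrix_apply, hadj] using hδ (c / d) (div_pos h3 h4)
  · rw [if_neg hadj, one_mul] at h
    have : a / (a + b) - c / (c + d) = 0 := by
      rw [div_sub_div _ _ (by positivity) (by positivity), div_eq_zero_iff]
      left
      linear_combination h
    rw [this]
    simp [SimpleGraph.adjMatrix_apply, hadj]

end WeightRatio

/-! ### Consequences of contraction for the one-variable recursion. -/

section Contraction

variable {β γ lam δ : ℝ}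

lemma partials_one (hβ : 0 ≤ β) (hγ : 0 < γ) (y : Fin 1 → ℝ) :
    partials β γ lam 1 y = fun i => (β * γ - 1) * Real.exp (y i)
      / ((β * Real.exp (y i) + 1) * (Real.exp (y i) + γ)) := by
  funext i
  obtain rfl : i = 0 := Subsingleton.elim _ _
  have hn : 0 < β * Real.exp (y 0) + 1 := by positivity
  have hd : 0 < Real.exp (y 0) + γ := by positivity
  have h1 : HasDerivAt (fun t => β * Real.exp t + 1) (β * Real.exp (y 0)) (y 0) :=
    ((Real.hasDerivAt_exp _).const_mul β).add_const 1
  have h2 : HasDerivAt (fun t => Real.exp t + γ) (Real.exp (y 0)) (y 0) :=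
    (Real.hasDerivAt_exp _).add_const γ
  have h3 := ((h1.div h2 hd.ne').log (div_pos hn hd).ne').const_add (Real.log lam)
  have h4 : (fun t : ℝ => H β γ lam 1 (Function.update y 0 t))
      = fun t => Real.log lam + Real.log ((β * Real.exp t + 1) / (Real.exp t + γ)) := by
    funext t
    simp [H]
  unfold partials
  rw [h4]
  refine h3.deriv.trans ?_
  simp only [Pi.div_apply]
  field_simp
  ring

lemma gradH_one_coe (hβ : 0 ≤ β) (hγ : 0 < γ) (y : Fin 1 → ℝ) :
    gradH β γ lam 1 (fun i => (y i : EReal)) = partials β γ lam 1 y := by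
  have hind : Topology.IsInducing (fun (x : Fin 1 → ℝ) (i : Fin 1) => (x i : EReal)) :=
    Topology.IsInducing.piMap fun _ => EReal.isEmbedding_coe.isInducing
  unfold gradH
  rw [← hind.nhds_eq_comap]
  have hcont : Continuous (partials β γ lam 1) := by
    have : partials β γ lam 1 = _ := funext fun y => partials_one hβ hγ y
    rw [this]
    refine continuous_pi fun i => Continuous.div (by fun_prop) (by fun_prop) fun y => ?_
    positivity
  exact (hcont.tendsto y).limUnder_eq

lemma DeltaContraction.abs_le {Δ : ℕ} (h : DeltaContraction Δ β γ lam δ) (hΔ : 1 ≤ Δ)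
    (hβ : 0 ≤ β) (hγ : 0 < γ) {t : ℝ} (ht : 0 < t) :
    |(β * γ - 1) * t / ((β * t + 1) * (t + γ))| ≤ δ := by
  have h1 := h 1 le_rfl hΔ (fun _ => (Real.log t : EReal))
  rw [gradH_one_coe hβ hγ (fun _ => Real.log t), partials_one hβ hγ] at h1
  have h2 := (norm_le_pi_norm _ (0 : Fin 1)).trans h1
  simpa only [Real.exp_log ht, Real.norm_eq_abs] using h2

/-- For `β = 0` the derivative is `-(t / (t + γ))` with `t = exp y`, whose absolute value tends to 1
and so exceeds `δ`. -/
lemma DeltaContraction.pos {Δ : ℕ} (h : DeltaContraction Δ β γ lam δ) (hΔ : 1 ≤ Δ)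
    (hβ : 0 ≤ β) (hγ : 0 < γ) (hδ : δ < 1) : 0 < β := by
  refine hβ.lt_of_ne fun hβ0 => ?_
  subst hβ0
  have hδ0 : 0 ≤ δ := (abs_nonneg _).trans (h.abs_le hΔ le_rfl hγ one_pos)
  have h1δ : 0 < 1 - δ := sub_pos.2 hδ
  -- The value `δ * γ / (1 - δ)` solves `t / (t + γ) = δ`; adding 1 goes beyond it.
  have ht : 0 < δ * γ / (1 - δ) + 1 := by positivity
  have h1 := h.abs_le hΔ le_rfl hγ ht
  set t := δ * γ / (1 - δ) + 1 with htd
  have e : (0 * γ - 1) * t / ((0 * t + 1) * (t + γ)) = -(t / (t + γ)) := by ring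
  rw [e, abs_neg, abs_of_pos (by positivity), div_le_iff₀ (by positivity)] at h1
  have : (t - 1) * (1 - δ) = δ * γ := by rw [htd]; field_simp; ring
  linarith

lemma DeltaContraction.abs_ratio_le {Δ : ℕ} (h : DeltaContraction Δ β γ lam δ) (hΔ : 1 ≤ Δ)
    (hβ : 0 ≤ β) (hγ : 0 < γ) {r : ℝ} (hr : 0 < r) :
    |(β * γ - 1) * r / ((1 + β * γ * r) * (1 + r))| ≤ δ := by
  have h1 := h.abs_le hΔ hβ hγ (mul_pos hγ hr)
  have e : (β * γ - 1) * (γ * r) / ((β * (γ * r) + 1) * (γ * r + γ))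
      = (β * γ - 1) * r / ((1 + β * γ * r) * (1 + r)) := by
    have : 0 < β * (γ * r) + 1 := by positivity
    have : 0 < 1 + β * γ * r := by positivity
    rw [div_eq_div_iff (by positivity) (by positivity)]
    ring
  rwa [e] at h1

end Contraction

/-! ### Spectral radius, ℓ² operator norm and Neumann series. -/

section Spectral

open scoped Matrix.Norms.L2Operator

variable {V : Type*} [Fintype V] [DecidableEq V]

lemma coe_mem_spectrum_map {A : Matrix V V ℝ} {k : ℝ} (hk : k ∈ spectrum ℝ A) :
    (k : ℂ) ∈ spectrum ℂ (A.map (fun x : ℝ => (x : ℂ))) := by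
  rw [spectrum.mem_iff, Matrix.isUnit_iff_isUnit_det, isUnit_iff_ne_zero, not_not] at hk ⊢
  have h1 : algebraMap ℂ (Matrix V V ℂ) k - A.map (fun x : ℝ => (x : ℂ))
      = Complex.ofRealHom.mapMatrix (algebraMap ℝ (Matrix V V ℝ) k - A) := by
    ext i j
    by_cases hij : i = j
    · subst hij; simp [Matrix.algebraMap_matrix_apply]
    · simp [Matrix.algebraMap_matrix_apply, hij]
  rw [h1, ← RingHom.map_det, hk, map_zero]

lemma norm_le_of_specRadius_eq {A : Matrix V V ℝ} (hA : A.IsSymm) {ρ : ℝ} (hρ : 0 ≤ ρ)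
    (h : specRadius A = ENNReal.ofReal ρ) : ‖A‖ ≤ ρ := by
  have hsa : IsSelfAdjoint (Matrix.toEuclideanCLM (n := V) (𝕜 := ℝ) A) := by
    have : IsSelfAdjoint A := by
      rw [isSelfAdjoint_iff, Matrix.star_eq_conjTranspose,
        Matrix.conjTranspose_eq_transpose_of_trivial]
      exact hA
    exact this.map (Matrix.toEuclideanCLM (n := V) (𝕜 := ℝ))
  have h1 := ContinuousLinearMap.spectralRadius_eq_nnnorm _ hsa
  have h2 : spectralRadius ℝ (Matrix.toEuclideanCLM (n := V) (𝕜 := ℝ) A) ≤ specRadius A := by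
    unfold spectralRadius specRadius
    rw [AlgEquiv.spectrum_eq (Matrix.toEuclideanCLM (n := V) (𝕜 := ℝ))]
    refine iSup₂_le fun k hk => ?_
    refine le_trans (le_of_eq ?_) (le_iSup₂ (f := fun (k : ℂ) _ => (‖k‖₊ : ENNReal)) (k : ℂ)
      (coe_mem_spectrum_map hk))
    simp
  rw [h1, h, ← Matrix.cstar_nnnorm_def, ENNReal.ofReal, ENNReal.coe_le_coe] at h2
  have h3 : ‖A‖ ≤ (ρ.toNNReal : ℝ) := NNReal.coe_le_coe.2 h2
  rwa [Real.coe_toNNReal _ hρ] at h3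

/-- The inverse of `1 - K` as a Neumann series, for a nonnegative symmetric matrix `K`. -/
lemma exists_neumann_inverse {K : Matrix V V ℝ} (hK : ∀ i j, 0 ≤ K i j) {q : ℝ} (hq : q < 1)
    (hKq : ‖K‖ ≤ q) :
    ∃ N : Matrix V V ℝ, N = 1 + N * K ∧ N = 1 + K * N ∧ (∀ i j, 0 ≤ N i j)
      ∧ ‖N‖ ≤ (1 - q)⁻¹ := by
  have hK1 : ‖K‖ < 1 := hKq.trans_lt hq
  have hsum : Summable fun k : ℕ => K ^ k := summable_geometric_of_norm_lt_one hK1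
  refine ⟨∑' k : ℕ, K ^ k, ?_, ?_, fun i j => ?_, ?_⟩
  · have := geom_series_mul_neg K hK1
    rw [mul_sub, mul_one] at this
    exact sub_eq_iff_eq_add.1 this
  · have := mul_neg_geom_series K hK1
    rw [sub_mul, one_mul] at this
    exact sub_eq_iff_eq_add.1 this
  · have hpow (k : ℕ) : ∀ i j, 0 ≤ (K ^ k) i j := by
      induction k with
      | zero =>
        intro i j
        rw [pow_zero, Matrix.one_apply]
        split_ifs <;> norm_num
      | succ k ih =>
        intro i j
        rw [pow_succ, Matrix.mul_apply]
        exact Finset.sum_nonneg fun l _ => mul_nonneg (ih i l) (hK l j)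
    have h1 : HasSum (fun k : ℕ => (K ^ k) i j) ((∑' k : ℕ, K ^ k) i j) :=
      Pi.hasSum.1 (Pi.hasSum.1 hsum.hasSum i) j
    exact h1.nonneg fun k => hpow k i j
  · refine (tsum_geometric_le_of_norm_lt_one K hK1).trans ?_
    have h1 : ‖(1 : Matrix V V ℝ)‖ ≤ 1 := by
      rw [Matrix.cstar_norm_def, map_one]
      exact ContinuousLinearMap.norm_id_le
    have h2 : (1 - ‖K‖)⁻¹ ≤ (1 - q)⁻¹ :=
      inv_anti₀ (sub_pos.2 hq) (sub_le_sub_left hKq 1)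
    linarith

/-- A matrix dominated entrywise by a submatrix of `N` has spectral radius at most `‖N‖`. -/
lemma specRadius_le_of_abs_le {p : V → Prop} [DecidablePred p] {M : Matrix {v // p v} {v // p v} ℝ}
    {N : Matrix V V ℝ} (hN : ∀ i j, 0 ≤ N i j) (hMN : ∀ w u, |M w u| ≤ N w u) {C : ℝ}
    (hC : ‖N‖ ≤ C) : specRadius M ≤ ENNReal.ofReal C := by
  have hC0 : 0 ≤ C := (norm_nonneg _).trans hC
  refine iSup₂_le fun k hk => ?_
  rw [spectrum.mem_iff, Matrix.isUnit_iff_isUnit_det, isUnit_iff_ne_zero, not_not] at hk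
  obtain ⟨x, hx0, hx⟩ := Matrix.exists_mulVec_eq_zero_iff.2 hk
  rw [Matrix.sub_mulVec, sub_eq_zero, Algebra.algebraMap_eq_smul_one, Matrix.smul_mulVec,
    Matrix.one_mulVec] at hx
  -- The moduli of an eigenvector, extended by zero, satisfy `‖k‖ y ≤ N y` entrywise.
  set y : V → ℝ := fun v => if h : p v then ‖x ⟨v, h⟩‖ else 0 with hy
  have hy0 (v : V) : 0 ≤ y v := by
    rw [hy]; dsimp only; split_ifs <;> simp
  have hsum (g : V → ℝ) : ∑ v, g v * y v = ∑ v : {v // p v}, g v * ‖x v‖ := by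
    have h1 : ∑ v ∈ Finset.univ.filter p, g v * y v = ∑ v, g v * y v := by
      refine Finset.sum_subset (Finset.filter_subset _ _) fun v _ hv => ?_
      have : ¬ p v := by simpa using hv
      simp [hy, this]
    rw [← h1, ← Finset.sum_subtype_eq_sum_filter, Finset.subtype_univ]
    refine Finset.sum_congr rfl fun v _ => ?_
    simp [hy, v.2]
  have hle (v : V) : ‖k‖ * y v ≤ (N.mulVec y) v := by
    have hR : (N.mulVec y) v = ∑ u : {v // p v}, N v u * ‖x u‖ := hsum (N v)
    rw [hR]
    by_cases hv : p v
    · have h1 := congrFun hx ⟨v, hv⟩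
      have h2 : y v = ‖x ⟨v, hv⟩‖ := by simp [hy, hv]
      rw [h2, ← norm_mul, ← smul_eq_mul, ← Pi.smul_apply, h1]
      refine (norm_sum_le _ _).trans (Finset.sum_le_sum fun u _ => ?_)
      rw [norm_mul]
      refine mul_le_mul_of_nonneg_right ?_ (norm_nonneg _)
      exact (Complex.norm_real (M ⟨v, hv⟩ u)).trans_le (hMN ⟨v, hv⟩ u)
    · have h2 : y v = 0 := by simp [hy, hv]
      rw [h2, mul_zero]
      exact Finset.sum_nonneg fun u _ => mul_nonneg (hN _ _) (norm_nonneg _)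
  set Y : EuclideanSpace ℝ V := WithLp.toLp 2 y with hY
  have h1 : ‖‖k‖ • Y‖ ≤ ‖Matrix.toEuclideanCLM (n := V) (𝕜 := ℝ) N Y‖ := by
    rw [EuclideanSpace.norm_eq, EuclideanSpace.norm_eq]
    refine Real.sqrt_le_sqrt (Finset.sum_le_sum fun v _ => ?_)
    have h2 : 0 ≤ ‖k‖ * y v := mul_nonneg (norm_nonneg _) (hy0 v)
    simp only [hY, Matrix.toEuclideanCLM_toLp, PiLp.smul_apply, smul_eq_mul, Real.norm_eq_abs,
      sq_abs]
    exact pow_le_pow_left₀ h2 (hle v) 2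
  have h2 : ‖Matrix.toEuclideanCLM (n := V) (𝕜 := ℝ) N Y‖ ≤ C * ‖Y‖ :=
    (ContinuousLinearMap.le_opNorm _ _).trans (mul_le_mul_of_nonneg_right hC (norm_nonneg _))
  have hY0 : 0 < ‖Y‖ := by
    rw [norm_pos_iff]
    intro h0
    apply hx0
    funext v
    have h3 : y v = 0 := congrFun (congrArg WithLp.ofLp h0) v
    simpa [hy, v.2] using h3
  rw [norm_smul, norm_norm] at h1
  have h3 : ‖k‖ ≤ C := le_of_mul_le_mul_right (h1.trans h2) hY0
  exact (ofReal_norm k).symm.trans_le (ENNReal.ofReal_le_ofReal h3)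

end Spectral

/-! ### Bounding influences by the inverse of `1 - δ A`. -/

section Influence

lemma oscLE_indicator {V : Type*} [DecidableEq V] (u : V) :
    OscLE (fun σ : V → ℤˣ => if σ u = 1 then 1 else 0) (fun j => if j = u then 1 else 0) := by
  intro σ j
  by_cases hj : j = u
  · subst hj
    have h2 : ¬ (-1 : ℤˣ) = 1 := by decide
    simp [h2]
  · simp [Function.update_of_ne (Ne.symm hj), hj]

open scoped Matrix.Norms.L2Operator

variable {V : Type*} [Fintype V] [DecidableEq V] (G : SimpleGraph V) [DecidableRel G.Adj]
  {β γ lam : ℝ}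

open Classical in
lemma condMarginal_eq_condExpect (hβ : 0 < β) (hγ : 0 < γ) (hlam : 0 < lam) (u : V) (s : ℤˣ)
    (S : Set (V → ℤˣ)) :
    condMarginal G β γ lam u s S
      = condExpect (weight G β γ lam) (Finset.univ.filter (· ∈ S))
        (fun σ => if σ u = s then 1 else 0) := by
  have hZ : 0 < ∑ σ, weight G β γ lam σ :=
    Finset.sum_pos (fun σ _ => weight_pos G hβ hγ hlam σ) Finset.univ_nonempty
  have h (T : Set (V → ℤˣ)) : gibbsProb G β γ lam T
      = (∑ σ ∈ Finset.univ.filter (· ∈ T), weight G β γ lam σ) / ∑ σ, weight G β γ lam σ := by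
    rw [gibbsProb, Finset.sum_filter, Finset.sum_div]
    refine Finset.sum_congr rfl fun σ _ => ?_
    split_ifs <;> simp [gibbs]
  rw [condMarginal, h, h, div_div_div_cancel_right₀ hZ.ne', condExpect]
  congr 1
  simp only [mul_ite, mul_one, mul_zero]
  rw [← Finset.sum_filter, Finset.filter_filter]
  refine Finset.sum_congr ?_ fun _ _ => rfl
  ext σ
  simp [and_comm]

/-- The influences are bounded by the entries of the inverse of `1 - δ A`. -/
lemma abs_influence_le (hβ : 0 < β) (hγ : 0 < γ) (hlam : 0 < lam) {δ : ℝ} (hδ0 : 0 ≤ δ)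
    (hδ : ∀ r : ℝ, 0 < r → |(β * γ - 1) * r / ((1 + β * γ * r) * (1 + r))| ≤ δ)
    {N : Matrix V V ℝ} (hNl : N = 1 + N * (δ • G.adjMatrix ℝ))
    (hNr : N = 1 + (δ • G.adjMatrix ℝ) * N) (hN : ∀ i j, 0 ≤ N i j)
    (Λ : Finset V) (τ : Λ → ℤˣ) (w u : {v : V // v ∉ Λ}) :
    |influence G β γ lam Λ τ w u| ≤ N w u := by
  classical
  set K : Matrix V V ℝ := δ • G.adjMatrix ℝ with hKdef
  have hK (i j : V) : 0 ≤ K i j := by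
    simp only [hKdef, Matrix.smul_apply, SimpleGraph.adjMatrix_apply, smul_eq_mul]
    split_ifs <;> simp [hδ0]
  have hKsymm (i j : V) : K i j = K j i := by
    simp [hKdef, SimpleGraph.adjMatrix_apply, G.adj_comm]
  have hNle (i j : V) : N i j = (1 : Matrix V V ℝ) i j + ∑ l, K j l * N i l := by
    conv_lhs => rw [hNl]
    rw [Matrix.add_apply, Matrix.mul_apply]
    simp only [hKsymm j, mul_comm]
  -- The row sums of `N` solve `c = 1 + K c`. As `c ≤ B`, this gives `K c = c - 1 ≤ (1 - B⁻¹) c`,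
  -- the strict contraction that makes the sweeps converge.
  set c : V → ℝ := fun i => ∑ j, N i j with hcdef
  have hcK (i : V) : c i = 1 + ∑ l, K i l * c l := by
    simp only [hcdef]
    conv_lhs => rw [hNr]
    simp only [Matrix.add_apply, Matrix.mul_apply, Finset.sum_add_distrib, Finset.mul_sum]
    rw [Finset.sum_comm]
    simp [Matrix.one_apply]
  have hc0 (i : V) : 0 ≤ c i := Finset.sum_nonneg fun j _ => hN i j
  have hc1 (i : V) : 1 ≤ c i := by
    have : 0 ≤ ∑ l, K i l * c l := Finset.sum_nonneg fun l _ => mul_nonneg (hK i l) (hc0 l)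
    linarith [hcK i]
  set B : ℝ := ∑ i, c i with hB
  have hcB (i : V) : c i ≤ B := Finset.single_le_sum (fun j _ => hc0 j) (Finset.mem_univ i)
  have hB1 : 1 ≤ B := (hc1 w).trans (hcB w)
  have hB0 : 0 < B := one_pos.trans_le hB1
  have hmem (s : ℤˣ) (v : V) (hv : v ∈ (Finset.univ.filter fun v => v ∉ Λ ∧ v ≠ (w : V)))
      (σ : V → ℤˣ)
      (hσ : σ ∈ Finset.univ.filter (· ∈ pinned Λ τ ∩ {σ : V → ℤˣ | σ w = s})) (t : ℤˣ) :
      Function.update σ v t ∈ Finset.univ.filter (· ∈ pinned Λ τ ∩ {σ : V → ℤˣ | σ w = s}) := by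
    simp only [Finset.mem_filter, Finset.mem_univ, true_and, Set.mem_inter_iff, pinned,
      Set.mem_ofPred_eq] at hv hσ ⊢
    refine ⟨fun a => ?_, ?_⟩
    · rw [Function.update_of_ne (ne_of_mem_of_not_mem a.2 hv.1)]
      exact hσ.1 a
    · rw [Function.update_of_ne hv.2.symm]
      exact hσ.2
  have hne (s : ℤˣ) :
      (Finset.univ.filter (· ∈ pinned Λ τ ∩ {σ : V → ℤˣ | σ w = s})).Nonempty := by
    refine ⟨fun v => if h : v ∈ Λ then τ ⟨v, h⟩ else s, ?_⟩
    simp only [Finset.mem_filter, Finset.mem_univ, true_and, Set.mem_inter_iff, pinned,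
      Set.mem_ofPred_eq]
    refine ⟨fun a => ?_, ?_⟩
    · simp
    · simp [w.2]
  -- The two conditionings may differ anywhere off `Λ`, and every such site except `w` is free. Row
  -- `w` of `N = 1 + N K`, with `K` symmetric, is an exact solution at the free sites and at least 1
  -- at `w`.
  have hdom := dominatesDiff_of_supersolution (weight_pos G hβ hγ hlam) (hne 1) (hne (-1))
    hK (fun i => by simp [hKdef]) (abs_siteProb_weight_sub_le G hβ hγ hlam hδ)
    (D := Finset.univ.filter fun v => v ∉ Λ)
    (F := Finset.univ.filter fun v => v ∉ Λ ∧ v ≠ (w : V))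
    (by
      intro σ hσ σ' hσ' j hj
      simp only [Finset.mem_filter, Finset.mem_univ, true_and, Set.mem_inter_iff, pinned,
        Set.mem_ofPred_eq, not_not] at hσ hσ' hj
      exact (hσ.1 ⟨j, hj⟩).trans (hσ'.1 ⟨j, hj⟩).symm)
    (hmem 1) (hmem (-1)) (b := fun j => N w j) (c := c) (hN w)
    (by
      intro j hj hjF
      simp only [Finset.mem_filter, Finset.mem_univ, true_and, not_and, not_not] at hj hjF
      rw [hNle, hjF hj, Matrix.one_apply_eq]
      exact le_add_of_nonneg_right
        (Finset.sum_nonneg fun l _ => mul_nonneg (hK _ l) (hN w l)))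
    (by
      intro v hv
      simp only [Finset.mem_filter, Finset.mem_univ, true_and] at hv
      rw [hNle w v, Matrix.one_apply_ne hv.2.symm, zero_add])
    (θ := 1 - B⁻¹) (sub_nonneg.2 (inv_le_one_of_one_le₀ hB1))
    (sub_lt_self _ (inv_pos.2 hB0)) hc1
    (by
      intro v
      have h1 : B⁻¹ * c v ≤ 1 := by
        rw [inv_mul_le_iff₀ hB0, mul_one]; exact hcB v
      linarith [hcK v])
  have h := hdom _ _ (oscLE_indicator (u : V))
  rw [influence, Matrix.of_apply, condMarginal_eq_condExpect G hβ hγ hlam,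
    condMarginal_eq_condExpect G hβ hγ hlam]
  simpa using h

end Influence

end TwoSpin

open scoped Matrix.Norms.L2Operator in
theorem theorem5p2 {V : Type*} [Fintype V] [DecidableEq V]
    (G : SimpleGraph V) [DecidableRel G.Adj]
    (Δ : ℕ) (hΔ : 1 ≤ Δ) (hGΔ : G.maxDegree = Δ)
    (ρ : ℝ) (hρ : 1 ≤ ρ) (hGρ : TwoSpin.specRadius (G.adjMatrix ℝ) = ENNReal.ofReal ρ)
    (ε : ℝ) (hε0 : 0 < ε) (hε1 : ε < 1)
    (β γ lam : ℝ) (hβ : 0 ≤ β) (hβγ : β ≤ γ) (hγ : 0 < γ) (hlam : 0 < lam)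
    (hcontr : TwoSpin.DeltaContraction Δ β γ lam ((1 - ε) / ρ))
    (Λ : Finset V) (τ : Λ → ℤˣ) :
    TwoSpin.specRadius (TwoSpin.influence G β γ lam Λ τ) ≤ ENNReal.ofReal ε⁻¹ := by
  have hρ0 : 0 < ρ := one_pos.trans_le hρ
  have hδ0 : 0 ≤ (1 - ε) / ρ := div_nonneg (sub_nonneg.2 hε1.le) hρ0.le
  have hδ1 : (1 - ε) / ρ < 1 := by
    rw [div_lt_one hρ0]; linarith
  have hβ0 : 0 < β := hcontr.pos hΔ hβ hγ hδ1
  have hA : ‖G.adjMatrix ℝ‖ ≤ ρ :=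
    TwoSpin.norm_le_of_specRadius_eq (SimpleGraph.isSymm_adjMatrix G) hρ0.le hGρ
  have hK : ‖((1 - ε) / ρ) • G.adjMatrix ℝ‖ ≤ 1 - ε := by
    rw [norm_smul, Real.norm_eq_abs, abs_of_nonneg hδ0]
    calc (1 - ε) / ρ * ‖G.adjMatrix ℝ‖ ≤ (1 - ε) / ρ * ρ := mul_le_mul_of_nonneg_left hA hδ0
      _ = 1 - ε := div_mul_cancel₀ _ hρ0.ne'
  have hK0 (i j : V) : 0 ≤ (((1 - ε) / ρ) • G.adjMatrix ℝ) i j := by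
    simp only [Matrix.smul_apply, SimpleGraph.adjMatrix_apply, smul_eq_mul]
    split_ifs <;> simp [hδ0]
  obtain ⟨N, hNl, hNr, hN0, hN⟩ :=
    TwoSpin.exists_neumann_inverse hK0 (sub_lt_self 1 hε0) hK
  rw [sub_sub_cancel] at hN
  exact TwoSpin.specRadius_le_of_abs_le hN0 (TwoSpin.abs_influence_le G hβ0 hγ hlam hδ0
    (fun r hr => hcontr.abs_ratio_le hΔ hβ hγ hr) hNl hNr hN0 Λ τ) hN
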